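/- Consider $M$ relays. Relay $i$ has a holding cost $C_i>0$ per packet and slot and channel success probabilities $f_i,l_i\in(0,1)$, and $\min_i l_i>\max_i f_i$. For each relay (index $i$ dropped) and each tax $\lambda\in\mathbb R$ consider the single-relay Markov decision process that arises when the constraint of sending exactly one packet per slot is relaxed to a time-averaged one with Lagrange multiplier $\lambda$: the queue length $X_n\in\mathbb N$ evolves as $$X_{n+1}=(X_n+\mu_nA_n-W_n)^+,$$ where all $A_n\sim\mathrm{Bernoulli}(f)$ and $W_n\sim\mathrm{Bernoulli}(l)$ are independent, $\mu_n\in\{0,1\}$ is chosen by a non-anticipating policy ($1$ is active, $0$ is passive), and the long-run expected average cost $$\limsup_{T\to\infty}\frac1T\,E\sum_{n=0}^{T-1}\bigl(CX_n+\lambda(1-\mu_n)\bigr)$$ is to be minimized. Let $V^\gamma$ be the value function of the corresponding $\gamma$-discounted problem, i.e. the infimum of the discounted cost over stationary policies. Then: 1. For every $\lambda$ the limits $V_\lambda(x)=\lim_{\gamma\uparrow1}\bigl(V^\gamma(x)-V^\gamma(0)\bigr)$ and $\sigma_\lambda=\lim_{\gamma\uparrow1}(1-\gamma)V^\gamma(0)$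 exist and satisfy the dynamic programming equation $$V(x)=Cx-\sigma+\min\Bigl(\{(1-f)(1-l)+fl\}V(x)+(1-f)l\,V((x-1)^+)+f(1-l)V(x+1);\ \lambda+(1-l)V(x)+l\,V((x-1)^+)\Bigr),$$ the first term belonging to $\mu=1$ and the second to $\mu=0$. From every initial state, $\sigma_\lambda$ is the minimal long-run expected average cost, and it is attained by every stationary policy that selects in each state a minimizing decision. 2. The problem is Whittle indexable: whenever for each $\lambda$ and each state $x$ a minimizing decision in this equation with $V=V_\lambda$, $\sigma=\sigma_\lambda$ is selected (ties broken arbitrarily), the sets $Z(\lambda)\subseteq\mathbb N$ of states with passive decision are decreasing in $\lambda$ (if $\lambda\le\lambda'$, then $Z(\lambda')\subseteq Z(\lambda)$), $Z(\lambda)=\mathbb N$ for all sufficiently small $\lambda$, and $Z(\lambda)$ decreases to the empty set as $\lambda\to\infty$, i.e. every state $x$ satisfies $x\notin Z(\lambda)$ for all sufficiently large $\lambda$. -/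

import Mathlib

open MeasureTheory Filter Topology Set

noncomputable section

/-- The parameters of one relay: holding cost `C > 0` per packet and slot, success probability
`f ∈ (0,1)` of the channel from the source to the relay, and success probability `l ∈ (0,1)` of the
channel from the relay to the destination. -/
structure Relay where
  C : ℝ
  f : ℝ
  l : ℝ
  C_pos : 0 < C
  f_pos : 0 < f
  f_lt_one : f < 1
  l_pos : 0 < l
  l_lt_one : l < 1

namespace Relay

variable (R : Relay)

/-- The success probability `f` as an element of the unit interval. -/
def fI : unitInterval := ⟨R.f, R.f_pos.le, R.f_lt_one.le⟩

/-- The success probability `l` as an element of the unit interval. -/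
def lI : unitInterval := ⟨R.l, R.l_pos.le, R.l_lt_one.le⟩

/-- A realisation of the channels: for each slot `n` the pair `(A n, W n)`. -/
abbrev Noise : Type := ℕ → Bool × Bool

/-- The law of the channels: all `A n` and `W n` are independent, `A n` is Bernoulli with parameter
`f` and `W n` is Bernoulli with parameter `l`. -/
def noiseLaw : Measure Noise :=
  Measure.infinitePi fun _ : ℕ =>
    (ProbabilityTheory.bernoulliMeasure true false R.fI).prod
      (ProbabilityTheory.bernoulliMeasure true false R.lI)

/-- A non-anticipating policy: a decision for the current slot as a function of the current queue
length and of the list of all earlier queue lengths (most recent first; its length is the index of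
the current slot). The decision `true` is `μ = 1` (active: a packet is sent to the relay), the
decision `false` is `μ = 0` (passive). -/
abbrev Policy : Type := ℕ → List ℕ → Bool

/-- The stationary policy given by a function of the current queue length. -/
def stationary (φ : ℕ → Bool) : Policy := fun x _ => φ x

/-- The queue length in slot `n` together with the earlier queue lengths, under the policy `π` from
the initial queue length `x₀`. It follows the recursion `X (n+1) = (X n + μ n * A n - W n)⁺`; the
truncated subtraction of natural numbers is the positive part. -/
def path (π : Policy) (x₀ : ℕ) (ω : Noise) : ℕ → ℕ × List ℕ
  | 0 => (x₀, [])
  | n + 1 =>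
    let s := path π x₀ ω n
    (s.1 + (π s.1 s.2).toNat * (ω n).1.toNat - (ω n).2.toNat, s.1 :: s.2)

/-- The cost in slot `n` under the tax `tax` on passivity: `C * X n + tax * (1 - μ n)`. -/
def slotCost (tax : ℝ) (π : Policy) (x₀ : ℕ) (ω : Noise) (n : ℕ) : ℝ :=
  R.C * ((path π x₀ ω n).1 : ℝ) +
    tax * (1 - ((π (path π x₀ ω n).1 (path π x₀ ω n).2).toNat : ℝ))

/-- The long-run expected average cost, a limit superior in the extended reals. -/
def avgCost (tax : ℝ) (π : Policy) (x₀ : ℕ) : EReal :=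
  limsup (fun T : ℕ =>
    ((∫ ω, ((1 / (T : ℝ)) * ∑ n ∈ Finset.range T, R.slotCost tax π x₀ ω n) ∂(R.noiseLaw) : ℝ) : EReal))
    atTop

/-- The expected `γ`-discounted cost over the infinite horizon. -/
def discCost (tax γ : ℝ) (π : Policy) (x₀ : ℕ) : ℝ :=
  ∫ ω, (∑' n : ℕ, γ ^ n * R.slotCost tax π x₀ ω n) ∂(R.noiseLaw)

/-- The value function of the `γ`-discounted problem: the infimum over all stationary policies. -/
def discValue (tax γ : ℝ) (x : ℕ) : ℝ :=
  ⨅ φ : ℕ → Bool, R.discCost tax γ (stationary φ) x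

/-- The argument of the minimum in the dynamic programming equation for the active decision. -/
def activeTerm (V : ℕ → ℝ) (x : ℕ) : ℝ :=
  ((1 - R.f) * (1 - R.l) + R.f * R.l) * V x + (1 - R.f) * R.l * V (x - 1) +
    R.f * (1 - R.l) * V (x + 1)

/-- The argument of the minimum in the dynamic programming equation for the passive decision. -/
def passiveTerm (tax : ℝ) (V : ℕ → ℝ) (x : ℕ) : ℝ :=
  tax + (1 - R.l) * V x + R.l * V (x - 1)

/-- `φ` picks in every state a decision that attains the minimum in the dynamic programming
equation. -/
def IsGreedy (tax : ℝ) (V : ℕ → ℝ) (φ : ℕ → Bool) : Prop :=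
  ∀ x, (φ x = true → R.activeTerm V x ≤ R.passiveTerm tax V x) ∧
    (φ x = false → R.passiveTerm tax V x ≤ R.activeTerm V x)

/-- `V` and `σ` are the value function and the constant of the dynamic programming equation of the
average-cost problem with tax `tax`. The two limits determine `V` and `σ` uniquely; the remaining
fields say that they are what the average-cost problem asks for. -/
structure IsAverageCostSolution (tax : ℝ) (V : ℕ → ℝ) (σ : ℝ) : Prop where
  tendsto_value : ∀ x,
    Tendsto (fun γ : ℝ => R.discValue tax γ x - R.discValue tax γ 0) (𝓝[<] 1) (𝓝 (V x))
  tendsto_const :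
    Tendsto (fun γ : ℝ => (1 - γ) * R.discValue tax γ 0) (𝓝[<] 1) (𝓝 σ)
  dpe : ∀ x, V x = R.C * x - σ + min (R.activeTerm V x) (R.passiveTerm tax V x)
  const_isLeast : ∀ x₀, IsLeast (range fun π : Policy => R.avgCost tax π x₀) (σ : EReal)
  greedy_optimal : ∀ φ, R.IsGreedy tax V φ → ∀ x₀, R.avgCost tax (stationary φ) x₀ = (σ : EReal)

/-- The set of passive states of a stationary policy. -/
def passiveSet (φ : ℕ → Bool) : Set ℕ := {x | φ x = false}

/-- Whittle indexability of the single-relay problem: for every tax the average-cost problem has its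
value function and constant, and, however an optimal decision is selected in every state and for
every tax (ties are broken arbitrarily), the set of passive states decreases with the tax, from the
whole state space as the tax tends to `-∞` to the empty set as the tax tends to `∞`. -/
def WhittleIndexable : Prop :=
  ∃ (V : ℝ → ℕ → ℝ) (σ : ℝ → ℝ),
    (∀ tax, R.IsAverageCostSolution tax (V tax) (σ tax)) ∧
    ∀ φ : ℝ → ℕ → Bool, (∀ tax, R.IsGreedy tax (V tax) (φ tax)) →
      Antitone (fun tax => passiveSet (φ tax)) ∧
      (∀ᶠ tax in atBot, passiveSet (φ tax) = univ) ∧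
      (∀ x, ∀ᶠ tax in atTop, x ∉ passiveSet (φ tax))

end Relay

end

noncomputable section

namespace Relay

variable (R : Relay)

/-! Write `b x = V x - V (x - 1)` for the slope. The active term minus the passive term is `f * s x
- tax`, where `s x = (1 - l) * b (x + 1) + l * b x`. Convexity of `V` therefore makes the passive
states of each problem upward closed.

Convexity and the bound `b x ≤ C / (l - f) * x` survive the Bellman operator (`HasShape.bellman`).
Value iteration gives both to the discounted value functions, with a bound that does not depend on
`γ`. The relative values are thus locally bounded, and every ultrafilter limit as `γ ↑ 1` is a
convex solution of the average-cost equation. Such solutions are unique (`value_unique`,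
`const_unique`), by downward comparison from a region where one solution is passive, so the full
limits exist. Optimality of `σ` joins two bounds: an Abelian inequality below (`le_avgCost`), and a
telescoping sum for greedy policies above (`IsConvexSolution.avgCost_le`).

Indexability is `not_passive_of_active`. Suppose a state is active for `tax` and passive for some
`tax' > tax`. At the last state `m` active for `tax`, the slope difference `d` of the two solutions
satisfies `d (m + 1) ≤ d m`, while the equations below `m` force `d` to be nonnegative. Since `f <
l`, the equations at `m` then give `d m = 0` and `σ' ≤ σ`, which contradicts `tax < tax'`. -/

instance : MeasurableSpace (List ℕ) := ⊤

instance : DiscreteMeasurableSpace (List ℕ) := ⟨fun _ => trivial⟩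

instance : IsProbabilityMeasure R.noiseLaw := by
  unfold noiseLaw; infer_instance

/-! ### The queue process and its one-step law -/

lemma path_congr (π : Policy) (x₀ : ℕ) {ω ω' : Noise} (n : ℕ) (h : ∀ k < n, ω k = ω' k) :
    path π x₀ ω n = path π x₀ ω' n := by
  induction n with
  | zero => rfl
  | succ n ih =>
    simp only [path]
    rw [ih fun k hk => h k (hk.trans n.lt_succ_self), h n n.lt_succ_self]

/-- The queue length and its history in slot `n` as a function of the first `n` noise variables. -/
def pathOfPrefix (π : Policy) (x₀ n : ℕ) (r : Finset.range n → Bool × Bool) : ℕ × List ℕ :=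
  path π x₀ (fun k => if h : k ∈ Finset.range n then r ⟨k, h⟩ else default) n

lemma pathOfPrefix_restrict (π : Policy) (x₀ n : ℕ) (ω : Noise) :
    pathOfPrefix π x₀ n (fun i => ω i) = path π x₀ ω n :=
  path_congr π x₀ n fun k hk => by simp [hk]

lemma path_le (π : Policy) (x₀ : ℕ) (ω : Noise) (n : ℕ) : (path π x₀ ω n).1 ≤ x₀ + n := by
  induction n with
  | zero => simp [path]
  | succ n ih =>
    simp only [path]
    have h : (π (path π x₀ ω n).1 (path π x₀ ω n).2).toNat * (ω n).1.toNat ≤ 1 :=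
      Nat.mul_le_mul (Bool.toNat_le _) (Bool.toNat_le _)
    omega

lemma measurable_path (π : Policy) (x₀ n : ℕ) : Measurable fun ω => path π x₀ ω n := by
  have h : (fun ω => path π x₀ ω n) = pathOfPrefix π x₀ n ∘ fun ω (i : Finset.range n) => ω i :=
    funext fun ω => (pathOfPrefix_restrict π x₀ n ω).symm
  rw [h]
  exact (Measurable.of_discrete).comp (measurable_pi_lambda _ fun i => measurable_pi_apply _)

/-- No growth condition on `G` is needed: the first `n` noise variables take only finitely many
values. -/
lemma integrable_path (π : Policy) (x₀ n : ℕ) (G : ℕ × List ℕ → ℝ) :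
    Integrable (fun ω => G (path π x₀ ω n)) R.noiseLaw := by
  have hm : Measurable fun (ω : Noise) (i : Finset.range n) => ω i :=
    measurable_pi_lambda _ fun i => measurable_pi_apply _
  have h : (fun ω => G (path π x₀ ω n)) =
      (G ∘ pathOfPrefix π x₀ n) ∘ fun ω (i : Finset.range n) => ω i :=
    funext fun ω => by simp [pathOfPrefix_restrict]
  rw [h]
  have := Measure.isProbabilityMeasure_map (μ := R.noiseLaw) hm.aemeasurable
  exact (Integrable.of_finite (μ := R.noiseLaw.map _)).comp_measurable hm

lemma indepFun_path (π : Policy) (x₀ n : ℕ) :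
    ProbabilityTheory.IndepFun (fun ω : Noise => ω n) (fun ω => path π x₀ ω n) R.noiseLaw := by
  have hi : ProbabilityTheory.iIndepFun (fun (i : ℕ) (ω : Noise) => ω i) R.noiseLaw :=
    ProbabilityTheory.iIndepFun_infinitePi (X := fun _ b => b) fun _ => measurable_id
  have h := hi.indepFun_finset {n} (Finset.range n) (by simp) fun i => measurable_pi_apply i
  have h2 := h.comp (φ := fun r => r ⟨n, Finset.mem_singleton_self n⟩) (ψ := pathOfPrefix π x₀ n)
    Measurable.of_discrete Measurable.of_discrete
  have h3 : (fun ω => path π x₀ ω n) =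
      pathOfPrefix π x₀ n ∘ fun ω (i : Finset.range n) => ω i :=
    funext fun ω => (pathOfPrefix_restrict π x₀ n ω).symm
  rw [h3]
  exact h2

/-- The probability of a value of the noise in one slot. -/
def noiseProb (b : Bool × Bool) : ℝ :=
  (if b.1 then R.f else 1 - R.f) * (if b.2 then R.l else 1 - R.l)

lemma noiseLaw_real_eval (n : ℕ) (b : Bool × Bool) :
    R.noiseLaw.real {ω | ω n = b} = R.noiseProb b := by
  have h : R.noiseLaw.real {ω | ω n = b} =
      ((ProbabilityTheory.bernoulliMeasure true false R.fI).prod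
      (ProbabilityTheory.bernoulliMeasure true false R.lI)).real {b} := by
    have := Measure.infinitePi_map_eval (fun _ : ℕ =>
      (ProbabilityTheory.bernoulliMeasure true false R.fI).prod
      (ProbabilityTheory.bernoulliMeasure true false R.lI)) n
    rw [← this, map_measureReal_apply (measurable_pi_apply n) (measurableSet_singleton _)]
    rfl
  obtain ⟨a, w⟩ := b
  rw [h, ← Set.singleton_prod_singleton, measureReal_prod_prod]
  rcases a <;> rcases w <;>
    simp [noiseProb, fI, lI]

/-- The conditional expectation of `h (X (n + 1))` given the queue length and the decision. -/
def nextMean (h : ℕ → ℝ) (x : ℕ) (a : Bool) : ℝ :=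
  if a then R.activeTerm h x else R.passiveTerm 0 h x

/-- Conditioning by hand: split according to the four values of the current noise, whose indicators
are independent of the past. -/
lemma integral_noise_path (π : Policy) (x₀ n : ℕ) (G : Bool × Bool → ℕ × List ℕ → ℝ) :
    ∫ ω, G (ω n) (path π x₀ ω n) ∂(R.noiseLaw) =
      ∫ ω, ∑ b, R.noiseProb b * G b (path π x₀ ω n) ∂(R.noiseLaw) := by
  have hG : ∀ ω, G (ω n) (path π x₀ ω n) =
      ∑ b, (if ω n = b then (1 : ℝ) else 0) * G b (path π x₀ ω n) := fun ω => by simp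
  have hmn : Measurable fun ω : Noise => ω n := measurable_pi_apply n
  have hind : ∀ b : Bool × Bool, Integrable
      (fun ω => (if ω n = b then (1 : ℝ) else 0) * G b (path π x₀ ω n)) R.noiseLaw := by
    intro b
    refine (R.integrable_path π x₀ n (G b)).bdd_mul (c := 1) ?_ ?_
    · exact ((Measurable.of_discrete (f := fun c : Bool × Bool => if c = b then (1 : ℝ) else 0)).comp
        hmn).aestronglyMeasurable
    · refine ae_of_all _ fun ω => ?_
      split_ifs <;> simp
  simp_rw [hG]
  rw [integral_finsetSum _ fun b _ => hind b,
    integral_finsetSum _ fun b _ => (R.integrable_path π x₀ n (G b)).const_mul _]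
  refine Finset.sum_congr rfl fun b _ => ?_
  have h := (R.indepFun_path π x₀ n).integral_fun_comp_mul_comp
    (f := fun c => if c = b then (1 : ℝ) else 0) (g := G b) hmn.aemeasurable
    (measurable_path π x₀ n).aemeasurable Measurable.of_discrete.aestronglyMeasurable
    Measurable.of_discrete.aestronglyMeasurable
  rw [h, integral_const_mul]
  congr 1
  rw [← R.noiseLaw_real_eval n b]
  have : (fun ω : Noise => if ω n = b then (1 : ℝ) else 0) = {ω : Noise | ω n = b}.indicator 1 := by
    ext ω; simp [Set.indicator_apply]
  rw [this]
  exact integral_indicator_one (hmn (measurableSet_singleton b))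

/-- The expected value of `h (X (n + 1))` by conditioning on the first `n` slots. -/
lemma integral_path_succ (π : Policy) (x₀ n : ℕ) (h : ℕ → ℝ) :
    ∫ ω, h (path π x₀ ω (n + 1)).1 ∂(R.noiseLaw) =
      ∫ ω, R.nextMean h (path π x₀ ω n).1
        (π (path π x₀ ω n).1 (path π x₀ ω n).2) ∂(R.noiseLaw) := by
  have := R.integral_noise_path π x₀ n
    fun b s => h (s.1 + (π s.1 s.2).toNat * b.1.toNat - b.2.toNat)
  refine (Eq.trans ?_ this).trans ?_
  · rfl
  · congr 1
    ext ω
    generalize path π x₀ ω n = s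
    cases hπ : π s.1 s.2 <;>
      simp [Fintype.sum_prod_type, nextMean, activeTerm, passiveTerm, noiseProb] <;> ring

end Relay

/-! ### Discounted costs and verification by the Bellman equation -/

namespace Relay

variable (R : Relay)

/-- The expected cost in slot `n`. -/
def meanCost (tax : ℝ) (π : Policy) (x₀ n : ℕ) : ℝ :=
  ∫ ω, R.slotCost tax π x₀ ω n ∂(R.noiseLaw)

/-- The expected value of `h` at the queue length in slot `n`. -/
def meanAt (h : ℕ → ℝ) (π : Policy) (x₀ n : ℕ) : ℝ :=
  ∫ ω, h (path π x₀ ω n).1 ∂(R.noiseLaw)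

/-- The cost of the decision `a` in state `x`, followed by the discounted terminal cost `h`. -/
def lookahead (tax γ : ℝ) (h : ℕ → ℝ) (x : ℕ) (a : Bool) : ℝ :=
  R.C * x + tax * (1 - (a.toNat : ℝ)) + γ * R.nextMean h x a

lemma integrable_slotCost (tax : ℝ) (π : Policy) (x₀ n : ℕ) :
    Integrable (fun ω => R.slotCost tax π x₀ ω n) R.noiseLaw :=
  R.integrable_path π x₀ n fun s => R.C * (s.1 : ℝ) + tax * (1 - ((π s.1 s.2).toNat : ℝ))

lemma abs_slotCost_le (tax : ℝ) (π : Policy) (x₀ : ℕ) (ω : Noise) (n : ℕ) :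
    |R.slotCost tax π x₀ ω n| ≤ R.C * (x₀ + n) + |tax| := by
  unfold slotCost
  have h1 : ((path π x₀ ω n).1 : ℝ) ≤ x₀ + n := by exact_mod_cast path_le π x₀ ω n
  have h2 : (0 : ℝ) ≤ (path π x₀ ω n).1 := Nat.cast_nonneg _
  have hC := R.C_pos
  refine (abs_add_le _ _).trans (add_le_add ?_ ?_)
  · rw [abs_of_nonneg (by positivity)]
    gcongr
  · cases π (path π x₀ ω n).1 (path π x₀ ω n).2 <;> simp

lemma abs_meanAt_le (h : ℕ → ℝ) (K : ℝ) (hK : ∀ x : ℕ, |h x| ≤ K * (x + 1)) (π : Policy)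
    (x₀ n : ℕ) : |R.meanAt h π x₀ n| ≤ K * (x₀ + n + 1) := by
  have h0 : 0 ≤ K := by simpa using (abs_nonneg _).trans (hK 0)
  have := norm_integral_le_of_norm_le_const (μ := R.noiseLaw)
    (f := fun ω => h (path π x₀ ω n).1) (C := K * (x₀ + n + 1)) (ae_of_all _ fun ω => by
      have h1 : ((path π x₀ ω n).1 : ℝ) ≤ x₀ + n := by exact_mod_cast path_le π x₀ ω n
      refine (hK _).trans ?_
      gcongr)
  simpa [meanAt] using this

lemma meanCost_add (tax γ : ℝ) (h : ℕ → ℝ) (π : Policy) (x₀ n : ℕ) :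
    R.meanCost tax π x₀ n + γ * R.meanAt h π x₀ (n + 1) =
      ∫ ω, R.lookahead tax γ h (path π x₀ ω n).1
        (π (path π x₀ ω n).1 (path π x₀ ω n).2) ∂(R.noiseLaw) := by
  rw [meanAt, integral_path_succ, meanCost, ← integral_const_mul, ← integral_add]
  · rfl
  · exact R.integrable_slotCost tax π x₀ n
  · exact (R.integrable_path π x₀ n fun s => R.nextMean h s.1 (π s.1 s.2)).const_mul γ

lemma meanAt_le_of_le_lookahead (tax γ : ℝ) (h h' : ℕ → ℝ)
    (hle : ∀ x a, h' x ≤ R.lookahead tax γ h x a) (π : Policy) (x₀ n : ℕ) :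
    R.meanAt h' π x₀ n ≤ R.meanCost tax π x₀ n + γ * R.meanAt h π x₀ (n + 1) := by
  rw [meanCost_add]
  exact integral_mono (R.integrable_path π x₀ n fun s => h' s.1)
    (R.integrable_path π x₀ n fun s => R.lookahead tax γ h s.1 (π s.1 s.2)) fun ω => hle _ _

/-- Two functions are allowed so that one statement serves the discounted case `h' = h` and the
average-cost case `γ = 1`, `h' = h + σ`. -/
lemma meanAt_eq_of_eq_lookahead (tax γ : ℝ) (h h' : ℕ → ℝ) (φ : ℕ → Bool)
    (heq : ∀ x, h' x = R.lookahead tax γ h x (φ x)) (x₀ n : ℕ) :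
    R.meanAt h' (stationary φ) x₀ n =
      R.meanCost tax (stationary φ) x₀ n + γ * R.meanAt h (stationary φ) x₀ (n + 1) := by
  rw [meanCost_add, meanAt]
  simp only [heq, stationary]

lemma meanAt_zero (h : ℕ → ℝ) (π : Policy) (x₀ : ℕ) : R.meanAt h π x₀ 0 = h x₀ := by
  simp [meanAt, path]

lemma summable_linear_mul_pow {γ : ℝ} (h0 : 0 ≤ γ) (h1 : γ < 1) (a b : ℝ) :
    Summable fun n : ℕ => γ ^ n * (a * n + b) := by
  have h := summable_pow_mul_geometric_of_norm_lt_one 1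
    (show ‖γ‖ < 1 by rwa [Real.norm_of_nonneg h0])
  have h' := summable_geometric_of_lt_one h0 h1
  refine ((h.mul_left a).add (h'.mul_left b)).congr fun n => ?_
  simp only [pow_one]
  ring

lemma hasSum_discCost (tax : ℝ) {γ : ℝ} (h0 : 0 ≤ γ) (h1 : γ < 1) (π : Policy) (x₀ : ℕ) :
    HasSum (fun n => γ ^ n * R.meanCost tax π x₀ n) (R.discCost tax γ π x₀) := by
  have hint : ∀ n, Integrable (fun ω => γ ^ n * R.slotCost tax π x₀ ω n) R.noiseLaw :=
    fun n => (R.integrable_slotCost tax π x₀ n).const_mul _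
  have hsum : Summable fun n => ∫ ω, ‖γ ^ n * R.slotCost tax π x₀ ω n‖ ∂(R.noiseLaw) := by
    refine Summable.of_nonneg_of_le (fun n => integral_nonneg fun ω => norm_nonneg _) (fun n => ?_)
      (summable_linear_mul_pow h0 h1 R.C (R.C * x₀ + |tax|))
    have := integral_mono (hint n).norm (integrable_const (γ ^ n * (R.C * n + (R.C * x₀ + |tax|))))
      fun ω => by
        simp only [norm_mul, norm_pow, Real.norm_of_nonneg h0]
        have := R.abs_slotCost_le tax π x₀ ω n
        rw [Real.norm_eq_abs]
        gcongr
        linarith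
    simpa using this
  have := hasSum_integral_of_summable_integral_norm hint hsum
  simp only [integral_const_mul] at this
  exact this

lemma tendsto_pow_mul_meanAt {γ : ℝ} (h0 : 0 ≤ γ) (h1 : γ < 1) (h : ℕ → ℝ) (K : ℝ)
    (hK : ∀ x : ℕ, |h x| ≤ K * (x + 1)) (π : Policy) (x₀ : ℕ) :
    Tendsto (fun n => γ ^ n * R.meanAt h π x₀ n) atTop (𝓝 0) := by
  refine squeeze_zero_norm (fun n => ?_)
    (summable_linear_mul_pow h0 h1 K (K * (x₀ + 1))).tendsto_atTop_zero
  have := R.abs_meanAt_le h K hK π x₀ n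
  rw [norm_mul, norm_pow, Real.norm_of_nonneg h0, Real.norm_eq_abs]
  gcongr
  linarith

/-- With `e` the mean of a candidate value function, the last sum collects the Bellman defects:
nonnegative for a subsolution, zero along a minimizing policy. -/
lemma sum_pow_mul_telescope (γ : ℝ) (c e : ℕ → ℝ) (T : ℕ) :
    ∑ n ∈ Finset.range T, γ ^ n * c n =
      e 0 - γ ^ T * e T + ∑ n ∈ Finset.range T, γ ^ n * (c n + γ * e (n + 1) - e n) := by
  induction T with
  | zero => simp
  | succ T ih => rw [Finset.sum_range_succ, Finset.sum_range_succ, ih]; ring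

lemma le_discCost (tax : ℝ) {γ : ℝ} (h0 : 0 ≤ γ) (h1 : γ < 1) (v : ℕ → ℝ) (K : ℝ)
    (hK : ∀ x : ℕ, |v x| ≤ K * (x + 1)) (hv : ∀ x a, v x ≤ R.lookahead tax γ v x a)
    (π : Policy) (x₀ : ℕ) : v x₀ ≤ R.discCost tax γ π x₀ := by
  have hl := (R.tendsto_pow_mul_meanAt h0 h1 v K hK π x₀).const_sub (v x₀)
  rw [sub_zero] at hl
  refine le_of_tendsto_of_tendsto' hl (R.hasSum_discCost tax h0 h1 π x₀).tendsto_sum_nat fun T => ?_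
  rw [sum_pow_mul_telescope γ _ (R.meanAt v π x₀), meanAt_zero]
  refine le_add_of_nonneg_right (Finset.sum_nonneg fun n _ => mul_nonneg (pow_nonneg h0 n) ?_)
  linarith [R.meanAt_le_of_le_lookahead tax γ v v hv π x₀ n]

lemma discCost_stationary_eq (tax : ℝ) {γ : ℝ} (h0 : 0 ≤ γ) (h1 : γ < 1) (v : ℕ → ℝ) (K : ℝ)
    (hK : ∀ x : ℕ, |v x| ≤ K * (x + 1)) (φ : ℕ → Bool)
    (hv : ∀ x, v x = R.lookahead tax γ v x (φ x)) (x₀ : ℕ) :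
    R.discCost tax γ (stationary φ) x₀ = v x₀ := by
  have hl := (R.tendsto_pow_mul_meanAt h0 h1 v K hK (stationary φ) x₀).const_sub (v x₀)
  rw [sub_zero] at hl
  refine tendsto_nhds_unique (R.hasSum_discCost tax h0 h1 _ x₀).tendsto_sum_nat (hl.congr fun T => ?_)
  rw [sum_pow_mul_telescope γ _ (R.meanAt v (stationary φ) x₀), meanAt_zero, left_eq_add]
  refine Finset.sum_eq_zero fun n _ => ?_
  rw [R.meanAt_eq_of_eq_lookahead tax γ v v φ hv x₀ n]
  ring

/-- The Bellman operator of the `γ`-discounted problem. -/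
def bellman (tax γ : ℝ) (V : ℕ → ℝ) (x : ℕ) : ℝ :=
  min (R.lookahead tax γ V x true) (R.lookahead tax γ V x false)

/-- Linear growth suffices for verification: the queue gains at most one packet per slot, so the
discounted terminal term vanishes. -/
lemma discValue_eq (tax : ℝ) {γ : ℝ} (h0 : 0 ≤ γ) (h1 : γ < 1) (v : ℕ → ℝ) (K : ℝ)
    (hK : ∀ x : ℕ, |v x| ≤ K * (x + 1)) (hv : ∀ x, v x = R.bellman tax γ v x) (x : ℕ) :
    R.discValue tax γ x = v x := by
  have hle : ∀ x a, v x ≤ R.lookahead tax γ v x a := by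
    rintro x (_ | _) <;> rw [hv x]
    exacts [min_le_right _ _, min_le_left _ _]
  have hex : ∀ x, ∃ a, v x = R.lookahead tax γ v x a := fun x => by
    rcases min_choice (R.lookahead tax γ v x true) (R.lookahead tax γ v x false) with h | h
    exacts [⟨true, (hv x).trans h⟩, ⟨false, (hv x).trans h⟩]
  choose φ hφ using hex
  have hb : ∀ ψ : ℕ → Bool, v x ≤ R.discCost tax γ (stationary ψ) x := fun ψ =>
    R.le_discCost tax h0 h1 v K hK hle _ x
  refine le_antisymm ?_ (le_ciInf hb)
  refine (ciInf_le ⟨v x, ?_⟩ φ).trans_eq (R.discCost_stationary_eq tax h0 h1 v K hK φ hφ x)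
  rintro _ ⟨ψ, rfl⟩
  exact hb ψ

lemma nextMean_mono (x : ℕ) (a : Bool) : Monotone fun V => R.nextMean V x a := by
  intro V W h
  have hf := R.f_pos
  have hf1 := sub_pos.2 R.f_lt_one
  have hl := R.l_pos
  have hl1 := sub_pos.2 R.l_lt_one
  have h1 := h x
  have h2 := h (x - 1)
  have h3 := h (x + 1)
  cases a <;> simp only [nextMean, activeTerm, passiveTerm, if_true, Bool.false_eq_true, if_false] <;>
    gcongr

lemma bellman_mono (tax : ℝ) {γ : ℝ} (h0 : 0 ≤ γ) : Monotone (R.bellman tax γ) := fun V W h x => by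
  unfold bellman lookahead
  gcongr ?_ ⊓ ?_
  · have := R.nextMean_mono x true h
    gcongr
  · have := R.nextMean_mono x false h
    gcongr

lemma tendsto_nextMean {ι : Type*} {F : Filter ι} {w : ι → ℕ → ℝ} {v : ℕ → ℝ}
    (h : ∀ x, Tendsto (fun i => w i x) F (𝓝 (v x))) (x : ℕ) (a : Bool) :
    Tendsto (fun i => R.nextMean (w i) x a) F (𝓝 (R.nextMean v x a)) := by
  cases a <;> simp only [nextMean, activeTerm, passiveTerm, if_true, Bool.false_eq_true, if_false]
  · exact (tendsto_const_nhds.add ((h x).const_mul _)).add ((h (x - 1)).const_mul _)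
  · exact (((h x).const_mul _).add ((h (x - 1)).const_mul _)).add ((h (x + 1)).const_mul _)

lemma tendsto_bellman {ι : Type*} {F : Filter ι} {w : ι → ℕ → ℝ} {v : ℕ → ℝ} {g : ι → ℝ} {γ : ℝ}
    (tax : ℝ) (hg : Tendsto g F (𝓝 γ)) (h : ∀ x, Tendsto (fun i => w i x) F (𝓝 (v x))) (x : ℕ) :
    Tendsto (fun i => R.bellman tax (g i) (w i) x) F (𝓝 (R.bellman tax γ v x)) :=
  ((hg.mul (R.tendsto_nextMean h x true)).const_add _).min
    ((hg.mul (R.tendsto_nextMean h x false)).const_add _)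

end Relay

/-! ### Convexity and slope bounds under the Bellman operator -/

/-- The backward difference of a function on `ℕ`, with the value `0` at `0`. -/
def backDiff (V : ℕ → ℝ) (x : ℕ) : ℝ := V x - V (x - 1)

@[simp] lemma backDiff_zero (V : ℕ → ℝ) : backDiff V 0 = 0 := by simp [backDiff]

lemma backDiff_succ (V : ℕ → ℝ) (x : ℕ) : backDiff V (x + 1) = V (x + 1) - V x := rfl

namespace Relay

variable (R : Relay)

/-- `V` is nondecreasing and convex, and its slope is at most that of the value function of the
policy that is always active. -/
structure HasShape (V : ℕ → ℝ) : Prop where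
  mono : Monotone (backDiff V)
  le : ∀ x, backDiff V x ≤ R.C / (R.l - R.f) * x

variable {R}

lemma HasShape.nonneg {V : ℕ → ℝ} (h : R.HasShape V) (x : ℕ) : 0 ≤ backDiff V x := by
  simpa using h.mono (Nat.zero_le x)

lemma HasShape.monotone {V : ℕ → ℝ} (h : R.HasShape V) : Monotone V :=
  monotone_nat_of_le_succ fun x => by
    have := h.nonneg (x + 1)
    rw [backDiff_succ] at this
    linarith

lemma HasShape.of_tendsto {ι : Type*} {F : Filter ι} [F.NeBot] {w : ι → ℕ → ℝ} {v : ℕ → ℝ}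
    (h : ∀ x, Tendsto (fun i => w i x) F (𝓝 (v x))) (hw : ∀ᶠ i in F, R.HasShape (w i)) :
    R.HasShape v := by
  have hb : ∀ x, Tendsto (fun i => backDiff (w i) x) F (𝓝 (backDiff v x)) := fun x =>
    (h x).sub (h (x - 1))
  exact ⟨fun x y hxy => le_of_tendsto_of_tendsto (hb x) (hb y) (hw.mono fun i hi => hi.mono hxy),
    fun x => le_of_tendsto (hb x) (hw.mono fun i hi => hi.le x)⟩

variable (R)

lemma activeTerm_eq (V : ℕ → ℝ) (x : ℕ) : R.activeTerm V x =
    V x + R.f * (1 - R.l) * backDiff V (x + 1) - (1 - R.f) * R.l * backDiff V x := by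
  simp only [activeTerm, backDiff, Nat.add_sub_cancel]
  ring

lemma passiveTerm_eq (tax : ℝ) (V : ℕ → ℝ) (x : ℕ) :
    R.passiveTerm tax V x = tax + V x - R.l * backDiff V x := by
  simp only [passiveTerm, backDiff]
  ring

/-- The expected slope of `V` at the queue length after service. -/
def serviceSlope (V : ℕ → ℝ) (x : ℕ) : ℝ := (1 - R.l) * backDiff V (x + 1) + R.l * backDiff V x

variable {R}

lemma HasShape.serviceSlope_mono {V : ℕ → ℝ} (h : R.HasShape V) : Monotone (R.serviceSlope V) :=
  fun x y hxy => by
    have h1 := h.mono hxy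
    have h2 := h.mono (Nat.succ_le_succ hxy)
    have hl := R.l_pos
    have hl1 := sub_pos.2 R.l_lt_one
    unfold serviceSlope
    gcongr

lemma HasShape.serviceSlope_nonneg {V : ℕ → ℝ} (h : R.HasShape V) (x : ℕ) :
    0 ≤ R.serviceSlope V x :=
  add_nonneg (mul_nonneg (sub_pos.2 R.l_lt_one).le (h.nonneg _)) (mul_nonneg R.l_pos.le (h.nonneg _))

lemma HasShape.serviceSlope_le {V : ℕ → ℝ} (h : R.HasShape V) (x : ℕ) :
    R.serviceSlope V x ≤ R.C / (R.l - R.f) * (x + 1 - R.l) := by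
  have h1 := mul_le_mul_of_nonneg_left (h.le (x + 1)) (sub_pos.2 R.l_lt_one).le
  have h2 := mul_le_mul_of_nonneg_left (h.le x) R.l_pos.le
  unfold serviceSlope
  push_cast at h1
  linarith

variable (R)

lemma backDiff_bellman_succ (tax γ : ℝ) (V : ℕ → ℝ) (x : ℕ) :
    backDiff (R.bellman tax γ V) (x + 1) = R.C + γ * R.serviceSlope V x +
      min (R.f * (γ * R.serviceSlope V (x + 1))) tax - min (R.f * (γ * R.serviceSlope V x)) tax := by
  -- Both decisions share the holding cost and the service part; only an expected arrival cost and
  -- the tax compete in the minimum.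
  have key : ∀ y, R.bellman tax γ V y = R.C * y + γ * (V y - R.l * backDiff V y) +
      min (R.f * (γ * R.serviceSlope V y)) tax := fun y => by
    rw [← min_add_add_left, bellman, lookahead, lookahead, nextMean, nextMean, if_pos rfl,
      if_neg Bool.false_ne_true, activeTerm_eq, passiveTerm_eq, serviceSlope]
    congr 1
    · simp only [Bool.toNat_true]; push_cast; ring
    · simp only [Bool.toNat_false]; push_cast; ring
  rw [backDiff_succ, key, key, serviceSlope, serviceSlope, backDiff_succ]
  push_cast
  ring

variable {R}

/-- With `k = γ * serviceSlope` and `m = min (f * k) tax`, the new slope at `x + 1` is `C + k x + m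
(x + 1) - m x`. Its increments are nonnegative because `m` is nondecreasing and grows at most `f <
1` times as fast as `k`. -/
lemma HasShape.bellman (hfl : R.f < R.l) {γ : ℝ} (h0 : 0 ≤ γ) (h1 : γ ≤ 1) (tax : ℝ) {V : ℕ → ℝ}
    (h : R.HasShape V) : R.HasShape (R.bellman tax γ V) := by
  have hf := R.f_pos
  have hf1 := R.f_lt_one
  set k : ℕ → ℝ := fun x => γ * R.serviceSlope V x with hk
  have kmono : ∀ x, k x ≤ k (x + 1) := fun x =>
    mul_le_mul_of_nonneg_left (h.serviceSlope_mono x.le_succ) h0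
  have k0 : ∀ x, 0 ≤ k x := fun x => mul_nonneg h0 (h.serviceSlope_nonneg x)
  have kle : ∀ x, k x ≤ R.C / (R.l - R.f) * (x + 1 - R.l) := fun x =>
    (mul_le_of_le_one_left (h.serviceSlope_nonneg x) h1).trans (h.serviceSlope_le x)
  have mmono : ∀ x, min (R.f * k x) tax ≤ min (R.f * k (x + 1)) tax := fun x =>
    min_le_min_right _ (mul_le_mul_of_nonneg_left (kmono x) hf.le)
  have mlip : ∀ x, min (R.f * k (x + 1)) tax - min (R.f * k x) tax ≤ R.f * (k (x + 1) - k x) := by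
    intro x
    have := mul_le_mul_of_nonneg_left (kmono x) hf.le
    rcases le_total (R.f * k x) tax with h' | h'
    · rw [min_eq_left h']
      linarith [min_le_left (R.f * k (x + 1)) tax]
    · rw [min_eq_right h']
      linarith [min_le_right (R.f * k (x + 1)) tax]
  constructor
  · refine monotone_nat_of_le_succ fun x => ?_
    rcases x with _ | x
    · rw [backDiff_zero, backDiff_bellman_succ]
      linarith [k0 0, mmono 0, R.C_pos]
    · rw [backDiff_bellman_succ, backDiff_bellman_succ]
      have := mul_le_mul_of_nonneg_right hf1.le (sub_nonneg.2 (kmono x))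
      linarith [mmono (x + 1), mlip x]
  · rintro (_ | x)
    · simp
    · rw [backDiff_bellman_succ]
      have h2 := mlip x
      have h3 := mul_le_mul_of_nonneg_left (kle x) (sub_pos.2 hf1).le
      have h4 := mul_le_mul_of_nonneg_left (kle (x + 1)) hf.le
      -- The slope constant is chosen so that `C` exactly balances the mean drift `f - l` of the
      -- active queue.
      have h5 : R.C = R.C / (R.l - R.f) * (R.l - R.f) :=
        (div_mul_cancel₀ _ (sub_pos.2 hfl).ne').symm
      push_cast at h4 ⊢
      have h6 : R.C + k x + (min (R.f * k (x + 1)) tax - min (R.f * k x) tax) ≤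
          R.C / (R.l - R.f) * (x + 1) := by
        nlinarith
      linarith

/-! ### Value iteration for the discounted problem -/

variable (R)

lemma lookahead_false (tax γ : ℝ) (V : ℕ → ℝ) (x : ℕ) : R.lookahead tax γ V x false =
    R.C * x + tax + γ * ((1 - R.l) * V x + R.l * V (x - 1)) := by
  simp [lookahead, nextMean, passiveTerm]

/-- The discounted dynamic programming equation has a convex nondecreasing solution of linear
growth, the limit of value iteration. -/
lemma exists_bellman_fixedPoint (hfl : R.f < R.l) (tax : ℝ) {γ : ℝ} (h0 : 0 ≤ γ) (h1 : γ < 1) :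
    ∃ v : ℕ → ℝ, R.HasShape v ∧ (∀ x, v x = R.bellman tax γ v x) ∧
      ∃ K : ℝ, ∀ x : ℕ, |v x| ≤ K * (x + 1) := by
  have hγ := sub_pos.2 h1
  have hC := R.C_pos
  -- The constants solve `b = |tax| + γ * b` and `a = C + γ * a`. Hence `-b` is a subsolution, and
  -- `a * x + b` is a supersolution because passivity never lengthens the queue.
  set b : ℝ := |tax| / (1 - γ) with hb
  have hb' : b = |tax| + γ * b := by rw [hb]; field_simp; ring
  have hb0 : 0 ≤ b := by positivity
  set a : ℝ := R.C / (1 - γ) with ha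
  have ha' : a = R.C + γ * a := by rw [ha]; field_simp; ring
  have ha0 : 0 ≤ a := by positivity
  let lo : ℕ → ℝ := fun _ => -b
  let hi : ℕ → ℝ := fun x => a * x + b
  have hlo : lo ≤ R.bellman tax γ lo := fun x => by
    have hx : 0 ≤ R.C * (x : ℝ) := by positivity
    refine le_min ?_ ?_
    · simp only [lookahead, nextMean, activeTerm, lo, if_true, Bool.toNat_true]
      push_cast
      nlinarith [abs_nonneg tax]
    · rw [lookahead_false]
      simp only [lo]
      nlinarith [neg_abs_le tax]
  have hhi : R.bellman tax γ hi ≤ hi := fun x => by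
    refine (min_le_right _ _).trans ?_
    rw [lookahead_false]
    have h2 : ((x - 1 : ℕ) : ℝ) ≤ x := by exact_mod_cast Nat.sub_le x 1
    have h3 : (1 - R.l) * hi x + R.l * hi (x - 1) ≤ hi x := by
      have : R.l * (a * ((x - 1 : ℕ) : ℝ)) ≤ R.l * (a * x) := by
        have := R.l_pos
        gcongr
      simp only [hi]
      linarith
    have h4 := mul_le_mul_of_nonneg_left h3 h0
    have h5 := le_abs_self tax
    have h6 : a * (x : ℝ) = (R.C + γ * a) * x := by rw [← ha']
    simp only [hi] at h4 ⊢
    linarith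
  -- Starting from the constant subsolution makes the iterates increasing and gives the first one
  -- zero slope, hence the required shape.
  set w : ℕ → ℕ → ℝ := fun n => (R.bellman tax γ)^[n] lo with hw
  have hmono := R.bellman_mono tax h0
  have wmono : Monotone w := hmono.monotone_iterate_of_le_map hlo
  have wsucc : ∀ n, w (n + 1) = R.bellman tax γ (w n) := fun n =>
    Function.iterate_succ_apply' _ _ _
  have whi : ∀ n, w n ≤ hi := fun n => by
    induction n with
    | zero =>
      intro x
      change -b ≤ a * x + b
      have : 0 ≤ a * (x : ℝ) := by positivity
      linarith
    | succ n ih => rw [wsucc]; exact (hmono ih).trans hhi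
  have wshape : ∀ n, R.HasShape (w n) := fun n => by
    induction n with
    | zero =>
      have : backDiff (w 0) = fun _ => 0 := funext fun x => by simp [hw, backDiff, lo]
      refine ⟨by rw [this]; exact monotone_const, fun x => ?_⟩
      rw [this]
      exact mul_nonneg (div_nonneg hC.le (sub_pos.2 hfl).le) (Nat.cast_nonneg x)
    | succ n ih => rw [wsucc]; exact ih.bellman hfl h0 h1.le tax
  have wlim : ∀ x, Tendsto (fun n => w n x) atTop (𝓝 (⨆ n, w n x)) := fun x =>
    tendsto_atTop_ciSup (fun m n hmn => wmono hmn x) ⟨hi x, by rintro _ ⟨n, rfl⟩; exact whi n x⟩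
  refine ⟨fun x => ⨆ n, w n x, HasShape.of_tendsto wlim (Eventually.of_forall wshape), fun x => ?_,
    a + b, fun x => ?_⟩
  · refine tendsto_nhds_unique ((tendsto_add_atTop_iff_nat 1).2 (wlim x)) ?_
    simp only [wsucc]
    exact R.tendsto_bellman tax tendsto_const_nhds wlim x
  · have hx : (0 : ℝ) ≤ x := Nat.cast_nonneg x
    have h2 : -b ≤ ⨆ n, w n x := ge_of_tendsto' (wlim x) fun n => wmono (Nat.zero_le n) x
    have h3 : ⨆ n, w n x ≤ a * x + b := le_of_tendsto' (wlim x) fun n => whi n x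
    rw [abs_le]
    constructor <;> nlinarith

end Relay

/-! ### Comparison of average-cost solutions for different taxes -/

namespace Relay

variable {R : Relay}

lemma HasShape.ext {V V' : ℕ → ℝ} (h0 : V 0 = V' 0) (h : ∀ x, backDiff V x = backDiff V' x) :
    V = V' := by
  ext x
  induction x with
  | zero => exact h0
  | succ x ih =>
    have := h (x + 1)
    rw [backDiff_succ, backDiff_succ] at this
    linarith

variable (R) in
/-- A normalized convex solution of the dynamic programming equation of the average-cost problem. -/
structure IsConvexSolution (tax : ℝ) (V : ℕ → ℝ) (σ : ℝ) : Prop where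
  zero : V 0 = 0
  shape : R.HasShape V
  dpe : ∀ x, V x = R.C * x - σ + min (R.activeTerm V x) (R.passiveTerm tax V x)

variable (R) in
lemma activeTerm_sub_passiveTerm (tax : ℝ) (V : ℕ → ℝ) (x : ℕ) :
    R.activeTerm V x - R.passiveTerm tax V x = R.f * R.serviceSlope V x - tax := by
  rw [activeTerm_eq, passiveTerm_eq, serviceSlope]
  ring

variable (R) in
lemma activeTerm_le_iff (tax : ℝ) (V : ℕ → ℝ) (x : ℕ) :
    R.activeTerm V x ≤ R.passiveTerm tax V x ↔ R.f * R.serviceSlope V x ≤ tax := by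
  rw [← sub_nonpos, activeTerm_sub_passiveTerm, sub_nonpos]

variable (R) in
lemma passiveTerm_le_iff (tax : ℝ) (V : ℕ → ℝ) (x : ℕ) :
    R.passiveTerm tax V x ≤ R.activeTerm V x ↔ tax ≤ R.f * R.serviceSlope V x := by
  rw [← sub_nonneg, activeTerm_sub_passiveTerm, sub_nonneg]

namespace IsConvexSolution

variable {tax tax' σ σ' : ℝ} {V V' : ℕ → ℝ}

lemma le_active (h : R.IsConvexSolution tax V σ) (x : ℕ) :
    σ - R.C * x ≤ R.f * (1 - R.l) * backDiff V (x + 1) - (1 - R.f) * R.l * backDiff V x := by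
  have := min_le_left (R.activeTerm V x) (R.passiveTerm tax V x)
  have := h.dpe x
  have := R.activeTerm_eq V x
  linarith

lemma le_passive (h : R.IsConvexSolution tax V σ) (x : ℕ) :
    σ - R.C * x ≤ tax - R.l * backDiff V x := by
  have := min_le_right (R.activeTerm V x) (R.passiveTerm tax V x)
  have := h.dpe x
  have := R.passiveTerm_eq tax V x
  linarith

lemma eq_active (h : R.IsConvexSolution tax V σ) {x : ℕ} (hx : R.f * R.serviceSlope V x ≤ tax) :
    σ - R.C * x = R.f * (1 - R.l) * backDiff V (x + 1) - (1 - R.f) * R.l * backDiff V x := by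
  have h1 := h.dpe x
  rw [min_eq_left ((R.activeTerm_le_iff tax V x).2 hx), activeTerm_eq] at h1
  linarith

lemma eq_passive (h : R.IsConvexSolution tax V σ) {x : ℕ} (hx : tax ≤ R.f * R.serviceSlope V x) :
    σ - R.C * x = tax - R.l * backDiff V x := by
  have h1 := h.dpe x
  rw [min_eq_right ((R.passiveTerm_le_iff tax V x).2 hx), passiveTerm_eq] at h1
  linarith

/-- If activity were optimal everywhere, the slope would be bounded by `tax / (f * l)`, and the
active equation could not absorb the unbounded holding cost `C * x`. -/
lemma exists_passive (h : R.IsConvexSolution tax V σ) :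
    ∃ N, ∀ x, N ≤ x → tax < R.f * R.serviceSlope V x := by
  suffices ∃ N, tax < R.f * R.serviceSlope V N from this.imp fun N hN x hx =>
    hN.trans_le (mul_le_mul_of_nonneg_left (h.shape.serviceSlope_mono hx) R.f_pos.le)
  by_contra! hall
  have hf := R.f_pos
  have hl := R.l_pos
  have hf1 := sub_pos.2 R.f_lt_one
  have hl1 := sub_pos.2 R.l_lt_one
  obtain ⟨n, hn⟩ := exists_nat_gt ((σ + (1 - R.f) * (tax / R.f)) / R.C)
  rw [div_lt_iff₀ R.C_pos] at hn
  have h1 := h.eq_active (hall n)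
  have h2 : R.l * backDiff V n ≤ tax / R.f := by
    rw [le_div_iff₀ hf]
    have h3 : 0 ≤ R.f * ((1 - R.l) * backDiff V (n + 1)) :=
      mul_nonneg hf.le (mul_nonneg hl1.le (h.shape.nonneg _))
    have h4 := hall n
    rw [serviceSlope] at h4
    linarith
  have h3 : 0 ≤ R.f * (1 - R.l) * backDiff V (n + 1) :=
    mul_nonneg (mul_pos hf hl1).le (h.shape.nonneg _)
  have h4 := mul_le_mul_of_nonneg_left h2 hf1.le
  linarith

/-- Downward induction from the region where `V'` is passive. In each state the decision optimal for
`V'` is tested in the equation for `V`: a passive state gives the bound outright, an active one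
transfers it from `y + 1` to `y`. -/
lemma backDiff_le (h : R.IsConvexSolution tax V σ) (h' : R.IsConvexSolution tax' V' σ')
    (htax : tax ≤ tax') (hσ : σ' ≤ σ) (x : ℕ) : backDiff V x ≤ backDiff V' x := by
  have hf := R.f_pos
  have hl := R.l_pos
  have hf1 := sub_pos.2 R.f_lt_one
  have hl1 := sub_pos.2 R.l_lt_one
  obtain ⟨N, hN⟩ := h'.exists_passive
  have hpass : ∀ y, tax' ≤ R.f * R.serviceSlope V' y → backDiff V y ≤ backDiff V' y := by
    intro y hy
    have h1 := h'.eq_passive hy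
    have h2 := h.le_passive y
    exact le_of_mul_le_mul_left (by linarith) hl
  suffices ∀ n y, N ≤ y + n → backDiff V y ≤ backDiff V' y from this N x (Nat.le_add_left _ _)
  intro n
  induction n with
  | zero => exact fun y hy => hpass y (hN y hy).le
  | succ n ih =>
    intro y hy
    rcases le_total tax' (R.f * R.serviceSlope V' y) with hp | ha
    · exact hpass y hp
    · have h1 := h'.eq_active ha
      have h2 := h.le_active y
      have h3 := mul_le_mul_of_nonneg_left (ih (y + 1) (by omega)) (mul_pos hf hl1).le
      exact le_of_mul_le_mul_left (by linarith) (mul_pos hf1 hl)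

/-- If `σ' < σ`, the slopes would be ordered; but at state `0`, where the backward slope vanishes,
the equation then gives `σ ≤ σ'`. -/
lemma const_mono (h : R.IsConvexSolution tax V σ) (h' : R.IsConvexSolution tax' V' σ')
    (htax : tax ≤ tax') : σ ≤ σ' := by
  by_contra! hσ
  rcases le_total tax' (R.f * R.serviceSlope V' 0) with hp | ha
  · have h1 := h'.eq_passive hp
    have h2 := h.le_passive 0
    simp only [backDiff_zero] at h1 h2
    linarith
  · have h1 := h'.eq_active ha
    have h2 := h.le_active 0
    have h3 := mul_le_mul_of_nonneg_left (h.backDiff_le h' htax hσ.le 1)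
      (mul_pos R.f_pos (sub_pos.2 R.l_lt_one)).le
    simp only [backDiff_zero, zero_add] at h1 h2
    linarith

lemma const_unique (h : R.IsConvexSolution tax V σ) (h' : R.IsConvexSolution tax V' σ') : σ = σ' :=
  le_antisymm (h.const_mono h' le_rfl) (h'.const_mono h le_rfl)

lemma value_unique (h : R.IsConvexSolution tax V σ) (h' : R.IsConvexSolution tax V' σ') :
    V = V' := by
  have hσ := h.const_unique h'
  exact HasShape.ext (h.zero.trans h'.zero.symm) fun x =>
    le_antisymm (h.backDiff_le h' le_rfl hσ.ge x) (h'.backDiff_le h le_rfl hσ.le x)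

/-- A state in which activity is optimal for one tax is not passive for any larger tax. -/
lemma not_passive_of_active (hfl : R.f < R.l) (h : R.IsConvexSolution tax V σ)
    (h' : R.IsConvexSolution tax' V' σ') (htax : tax < tax') {x : ℕ}
    (hx : R.f * R.serviceSlope V x ≤ tax) : R.f * R.serviceSlope V' x < tax' := by
  by_contra! hx'
  have hf := R.f_pos
  have hl := R.l_pos
  have hf1 := sub_pos.2 R.f_lt_one
  have hl1 := sub_pos.2 R.l_lt_one
  obtain ⟨N, hN⟩ := h.exists_passive
  have hbound : ∀ y, R.f * R.serviceSlope V y ≤ tax → y ≤ N := fun y hy => by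
    by_contra! hlt
    exact (hN y hlt.le).not_ge hy
  classical
  -- At the last active state `m` for `tax`, convexity of `V'` makes passivity optimal for `tax'` as
  -- well, since `x ≤ m`.
  set m := Nat.findGreatest (fun y => R.f * R.serviceSlope V y ≤ tax) N with hm
  have hma : R.f * R.serviceSlope V m ≤ tax :=
    Nat.findGreatest_spec (P := fun y => R.f * R.serviceSlope V y ≤ tax) (hbound x hx) hx
  have hxm : x ≤ m := Nat.le_findGreatest (hbound x hx) hx
  have hmp : tax < R.f * R.serviceSlope V (m + 1) := by
    by_contra! hle
    exact (Nat.le_findGreatest (hbound _ hle) hle).not_gt (Nat.lt_succ_self m)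
  have hmp' : tax' ≤ R.f * R.serviceSlope V' m :=
    hx'.trans (mul_le_mul_of_nonneg_left (h'.shape.serviceSlope_mono hxm) hf.le)
  have hσ := h.const_mono h' htax.le
  have hactive : ∀ y ≤ m, R.f * R.serviceSlope V y ≤ tax := fun y hy =>
    (mul_le_mul_of_nonneg_left (h.shape.serviceSlope_mono hy) hf.le).trans hma
  have hstep : ∀ y ≤ m, (1 - R.f) * R.l * (backDiff V' y - backDiff V y) + (σ' - σ) ≤
      R.f * (1 - R.l) * (backDiff V' (y + 1) - backDiff V (y + 1)) := fun y hy => by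
    have h1 := h.eq_active (hactive y hy)
    have h2 := h'.le_active y
    linarith
  have hnonneg : ∀ y ≤ m, 0 ≤ backDiff V' y - backDiff V y := by
    intro y
    induction y with
    | zero => simp
    | succ y ih =>
      intro hy
      have h1 := hstep y (by omega)
      have h2 := mul_nonneg (mul_pos hf1 hl).le (ih (by omega))
      exact nonneg_of_mul_nonneg_right (by linarith) (mul_pos hf hl1)
  have hup : R.l * (backDiff V' (m + 1) - backDiff V (m + 1)) ≤ tax' - tax - (σ' - σ) := by
    have h1 := h.eq_passive hmp.le
    have h2 := h'.le_passive (m + 1)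
    linarith
  have hlow : tax' - tax - (σ' - σ) ≤ R.l * (backDiff V' m - backDiff V m) := by
    have h1 := h.le_passive m
    have h2 := h'.eq_passive hmp'
    linarith
  have hd : backDiff V' (m + 1) - backDiff V (m + 1) ≤ backDiff V' m - backDiff V m :=
    le_of_mul_le_mul_left (hup.trans hlow) hl
  have h1 := hstep m le_rfl
  have h2 := mul_le_mul_of_nonneg_left hd (mul_pos hf hl1).le
  have h3 := hnonneg m le_rfl
  -- The factor arises as `(1 - f) * l - f * (1 - l) = l - f`.
  have h4 : (R.l - R.f) * (backDiff V' m - backDiff V m) + (σ' - σ) ≤ 0 := by linarith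
  have h5 := mul_nonneg (sub_pos.2 hfl).le h3
  have h6 : (backDiff V' m - backDiff V m) = 0 :=
    (mul_eq_zero.1 (le_antisymm (by linarith) h5)).resolve_left (sub_pos.2 hfl).ne'
  rw [h6] at hlow
  linarith

end IsConvexSolution

end Relay

/-! ### The vanishing discount limit -/

namespace Relay

variable (R : Relay)

lemma discValue_spec (hfl : R.f < R.l) (tax : ℝ) {γ : ℝ} (h0 : 0 ≤ γ) (h1 : γ < 1) :
    R.HasShape (R.discValue tax γ) ∧
      (∀ x, R.discValue tax γ x = R.bellman tax γ (R.discValue tax γ) x) ∧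
      ∀ π x, R.discValue tax γ x ≤ R.discCost tax γ π x := by
  obtain ⟨v, hs, hv, K, hK⟩ := R.exists_bellman_fixedPoint hfl tax h0 h1
  have hd : R.discValue tax γ = v := funext (R.discValue_eq tax h0 h1 v K hK hv)
  rw [hd]
  refine ⟨hs, hv, R.le_discCost tax h0 h1 v K hK ?_⟩
  rintro x (_ | _) <;> rw [hv x]
  exacts [min_le_right _ _, min_le_left _ _]

lemma nextMean_sub_const (V : ℕ → ℝ) (c : ℝ) (x : ℕ) (a : Bool) :
    R.nextMean (fun y => V y - c) x a = R.nextMean V x a - c := by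
  cases a <;> simp only [nextMean, activeTerm, passiveTerm, if_true, Bool.false_eq_true, if_false] <;>
    ring

lemma bellman_sub_const (tax γ : ℝ) (V : ℕ → ℝ) (c : ℝ) (x : ℕ) :
    R.bellman tax γ (fun y => V y - c) x = R.bellman tax γ V x - γ * c := by
  simp only [bellman, lookahead, nextMean_sub_const]
  rw [← min_sub_sub_right]
  congr 1 <;> ring

lemma bellman_one (tax : ℝ) (V : ℕ → ℝ) (x : ℕ) :
    R.bellman tax 1 V x = R.C * x + min (R.activeTerm V x) (R.passiveTerm tax V x) := by
  rw [← min_add_add_left, bellman, lookahead, lookahead, nextMean, nextMean, if_pos rfl,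
    if_neg Bool.false_ne_true]
  congr 1
  · simp
  · simp [passiveTerm]; ring

/-- The relative value function of the `γ`-discounted problem. -/
def relValue (tax γ : ℝ) (x : ℕ) : ℝ := R.discValue tax γ x - R.discValue tax γ 0

lemma relValue_zero (tax γ : ℝ) : R.relValue tax γ 0 = 0 := sub_self _

lemma relValue_shape (hfl : R.f < R.l) (tax : ℝ) {γ : ℝ} (h0 : 0 ≤ γ) (h1 : γ < 1) :
    R.HasShape (R.relValue tax γ) := by
  have h : backDiff (R.relValue tax γ) = backDiff (R.discValue tax γ) := by
    ext x
    simp [backDiff, relValue]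
  have hs := (R.discValue_spec hfl tax h0 h1).1
  exact ⟨h ▸ hs.mono, h ▸ hs.le⟩

lemma relValue_eq (hfl : R.f < R.l) (tax : ℝ) {γ : ℝ} (h0 : 0 ≤ γ) (h1 : γ < 1) (x : ℕ) :
    R.relValue tax γ x =
      R.bellman tax γ (R.relValue tax γ) x - (1 - γ) * R.discValue tax γ 0 := by
  have h2 := (R.discValue_spec hfl tax h0 h1).2.1 x
  have h3 := R.bellman_sub_const tax γ (R.discValue tax γ) (R.discValue tax γ 0) x
  unfold relValue
  rw [h3]
  linarith

-- Summing the slope bound gives an estimate free of `γ`, which supplies the compactness for the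
-- limit.
variable {R} in
lemma HasShape.le_sq {V : ℕ → ℝ} (h : R.HasShape V) (h0 : V 0 = 0) (hfl : R.f < R.l) (x : ℕ) :
    V x ≤ R.C / (R.l - R.f) * (x : ℝ) ^ 2 := by
  have hα : 0 ≤ R.C / (R.l - R.f) := div_nonneg R.C_pos.le (sub_pos.2 hfl).le
  induction x with
  | zero => simp [h0]
  | succ x ih =>
    have h1 := h.le (x + 1)
    rw [backDiff_succ] at h1
    push_cast at h1 ⊢
    nlinarith [mul_nonneg hα (Nat.cast_nonneg (α := ℝ) x)]

lemma eventually_discount : ∀ᶠ γ : ℝ in 𝓝[<] 1, 0 ≤ γ ∧ γ < 1 := by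
  filter_upwards [Ico_mem_nhdsLT (show (0 : ℝ) < 1 by norm_num)] with γ hγ using hγ

lemma tendsto_discount : Tendsto (fun γ : ℝ => γ) (𝓝[<] 1) (𝓝 1) :=
  tendsto_id.mono_left nhdsWithin_le_nhds

/-- Along every ultrafilter of discount factors increasing to `1` the relative value functions
converge to a solution of the average-cost dynamic programming equation. -/
lemma exists_ultrafilter_limit (hfl : R.f < R.l) (tax : ℝ) (F : Ultrafilter ℝ)
    (hF : (F : Filter ℝ) ≤ 𝓝[<] 1) :
    ∃ V σ, R.IsConvexSolution tax V σ ∧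
      (∀ x, Tendsto (fun γ => R.relValue tax γ x) F (𝓝 (V x))) ∧
      Tendsto (fun γ => (1 - γ) * R.discValue tax γ 0) F (𝓝 σ) := by
  have hev : ∀ᶠ γ : ℝ in F, 0 ≤ γ ∧ γ < 1 := hF eventually_discount
  have hlim : ∀ x, ∃ y, Tendsto (fun γ => R.relValue tax γ x) F (𝓝 y) := fun x => by
    obtain ⟨y, -, hy⟩ := (isCompact_Icc (a := 0)
      (b := R.C / (R.l - R.f) * (x : ℝ) ^ 2)).ultrafilter_le_nhds
      (F.map fun γ => R.relValue tax γ x) (by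
        rw [Filter.le_principal_iff]
        refine hev.mono fun γ hγ => ?_
        have hs := R.relValue_shape hfl tax hγ.1 hγ.2
        refine ⟨?_, hs.le_sq (R.relValue_zero tax γ) hfl x⟩
        exact (R.relValue_zero tax γ).ge.trans (hs.monotone (Nat.zero_le x)))
    exact ⟨y, hy⟩
  choose V hV using hlim
  have hid : Tendsto (fun γ : ℝ => γ) F (𝓝 1) := tendsto_discount.mono_left hF
  have hB := R.tendsto_bellman tax hid hV
  have hzero : V 0 = 0 :=
    tendsto_nhds_unique (hV 0) (by simp only [relValue_zero]; exact tendsto_const_nhds)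
  -- The relative value vanishes at `0`, so the equation there expresses the constant through
  -- convergent quantities; no separate bound on it is needed.
  have hσ : Tendsto (fun γ => (1 - γ) * R.discValue tax γ 0) F (𝓝 (R.bellman tax 1 V 0)) := by
    refine (hB 0).congr' (hev.mono fun γ hγ => ?_)
    have := R.relValue_eq hfl tax hγ.1 hγ.2 0
    rw [relValue_zero] at this
    linarith
  refine ⟨V, _, ⟨hzero, ?_, fun x => ?_⟩, hV, hσ⟩
  · exact HasShape.of_tendsto hV (hev.mono fun γ hγ => R.relValue_shape hfl tax hγ.1 hγ.2)
  · have h1 : V x = R.bellman tax 1 V x - R.bellman tax 1 V 0 :=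
      tendsto_nhds_unique (hV x) (((hB x).sub hσ).congr' (hev.mono fun γ hγ =>
        (R.relValue_eq hfl tax hγ.1 hγ.2 x).symm))
    rw [h1, R.bellman_one tax V x]
    ring

/-- The vanishing discount limits exist and solve the average-cost dynamic programming equation. -/
lemma exists_vanishing_discount_limit (hfl : R.f < R.l) (tax : ℝ) :
    ∃ V σ, R.IsConvexSolution tax V σ ∧
      (∀ x, Tendsto (fun γ => R.relValue tax γ x) (𝓝[<] 1) (𝓝 (V x))) ∧
      Tendsto (fun γ => (1 - γ) * R.discValue tax γ 0) (𝓝[<] 1) (𝓝 σ) := by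
  obtain ⟨V, σ, h, -, -⟩ := R.exists_ultrafilter_limit hfl tax (Ultrafilter.of (𝓝[<] 1))
    (Ultrafilter.of_le _)
  -- Uniqueness of convex solutions identifies the limits along all ultrafilters.
  refine ⟨V, σ, h, fun x => (tendsto_iff_ultrafilter _ _ _).2 fun F hF => ?_,
    (tendsto_iff_ultrafilter _ _ _).2 fun F hF => ?_⟩
  · obtain ⟨V', σ', h', hV', -⟩ := R.exists_ultrafilter_limit hfl tax F hF
    rw [h.value_unique h']
    exact hV' x
  · obtain ⟨V', σ', h', -, hσ'⟩ := R.exists_ultrafilter_limit hfl tax F hF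
    rw [h.const_unique h']
    exact hσ'

/-! ### Average-cost optimality and indexability -/

lemma avgCost_eq (tax : ℝ) (π : Policy) (x₀ : ℕ) : R.avgCost tax π x₀ =
    limsup (fun T : ℕ =>
      ((1 / (T : ℝ) * ∑ n ∈ Finset.range T, R.meanCost tax π x₀ n : ℝ) : EReal)) atTop := by
  unfold avgCost meanCost
  congr 1
  ext T
  rw [integral_const_mul, integral_finsetSum _ fun n _ => R.integrable_slotCost tax π x₀ n]

/-- Abel summation writes the discounted sum as a convex combination of partial sums of `d`, with
weights `γ ^ T` and `(1 - γ) * γ ^ n`. -/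
lemma sum_pow_mul_le {γ K : ℝ} (h0 : 0 ≤ γ) (h1 : γ ≤ 1) (d : ℕ → ℝ)
    (hK : ∀ T, ∑ n ∈ Finset.range T, d n ≤ K) (T : ℕ) :
    ∑ n ∈ Finset.range T, γ ^ n * d n ≤ K := by
  have habel : ∀ T, ∑ n ∈ Finset.range T, γ ^ n * d n = γ ^ T * ∑ n ∈ Finset.range T, d n +
      (1 - γ) * ∑ n ∈ Finset.range T, γ ^ n * ∑ k ∈ Finset.range (n + 1), d k := fun T => by
    induction T with
    | zero => simp
    | succ T ih =>
      rw [Finset.sum_range_succ, ih, Finset.sum_range_succ (fun n => γ ^ n * _),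
        Finset.sum_range_succ d]
      ring
  have hgeom : ∀ T, γ ^ T + (1 - γ) * ∑ n ∈ Finset.range T, γ ^ n = 1 := fun T => by
    rw [mul_comm, geom_sum_mul_neg]
    ring
  have hγ := sub_nonneg.2 h1
  calc ∑ n ∈ Finset.range T, γ ^ n * d n
      ≤ γ ^ T * K + (1 - γ) * ∑ n ∈ Finset.range T, γ ^ n * K := by
        rw [habel]
        gcongr
        · exact hK _
        · exact hK _
    _ = (γ ^ T + (1 - γ) * ∑ n ∈ Finset.range T, γ ^ n) * K := by
        rw [← Finset.sum_mul]; ring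
    _ = K := by rw [hgeom, one_mul]

/-- The Abelian inequality: a limit of normalized discounted values bounds the long-run average
cost of every policy from below. -/
lemma le_avgCost (hfl : R.f < R.l) {tax σ : ℝ} {x₀ : ℕ}
    (hσ : Tendsto (fun γ => (1 - γ) * R.discValue tax γ x₀) (𝓝[<] 1) (𝓝 σ)) (π : Policy) :
    (σ : EReal) ≤ R.avgCost tax π x₀ := by
  by_contra! hlt
  obtain ⟨s, hs, hsσ⟩ := EReal.lt_iff_exists_real_btwn.1 hlt
  rw [avgCost_eq] at hs
  obtain ⟨N, hN⟩ := eventually_atTop.1 (eventually_lt_of_limsup_lt hs)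
  set c := R.meanCost tax π x₀
  set S : ℕ → ℝ := fun T => ∑ n ∈ Finset.range T, (c n - s)
  -- The partial sums are negative beyond `N`, and only finitely many remain. The factor `1 - γ`
  -- later removes `K` in the limit.
  obtain ⟨K, hK⟩ : ∃ K, ∀ T, S T ≤ K := by
    obtain ⟨K, hK⟩ := ((Finset.range (N + 1)).image S).exists_le
    refine ⟨max K 0, fun T => ?_⟩
    rcases lt_or_ge T (N + 1) with hT | hT
    · exact le_max_of_le_left (hK _ (Finset.mem_image_of_mem _ (Finset.mem_range.2 hT)))
    · refine le_max_of_le_right ?_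
      have h1 := EReal.coe_lt_coe_iff.1 (hN T (by omega))
      have hT0 : (0 : ℝ) < T := by exact_mod_cast (by omega : 0 < T)
      rw [one_div, inv_mul_lt_iff₀ hT0] at h1
      simp only [S, Finset.sum_sub_distrib, Finset.sum_const, Finset.card_range, nsmul_eq_mul]
      linarith
  have hle : ∀ᶠ γ : ℝ in 𝓝[<] 1, (1 - γ) * R.discValue tax γ x₀ ≤ (1 - γ) * K + s := by
    refine eventually_discount.mono fun γ ⟨h0, h1⟩ => ?_
    have h2 := (R.discValue_spec hfl tax h0 h1).2.2 π x₀
    have h3 : HasSum (fun n => γ ^ n * (c n - s)) (R.discCost tax γ π x₀ - (1 - γ)⁻¹ * s) :=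
      ((R.hasSum_discCost tax h0 h1 π x₀).sub
        ((hasSum_geometric_of_lt_one h0 h1).mul_right s)).congr_fun fun n => by ring
    have h4 := le_of_tendsto' h3.tendsto_sum_nat (sum_pow_mul_le h0 h1.le _ hK)
    have h5 := sub_pos.2 h1
    calc (1 - γ) * R.discValue tax γ x₀ ≤ (1 - γ) * (K + (1 - γ)⁻¹ * s) := by
          gcongr
          linarith
      _ = (1 - γ) * K + s := by field_simp
  have hlim : Tendsto (fun γ : ℝ => (1 - γ) * K + s) (𝓝[<] 1) (𝓝 ((1 - 1) * K + s)) :=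
    ((tendsto_discount.const_sub 1).mul_const K).add_const s
  have h6 := le_of_tendsto_of_tendsto hσ hlim hle
  have h7 := EReal.coe_lt_coe_iff.1 hsσ
  linarith

variable {R}

/-- The costs telescope to `T * σ + V x₀ - E V (X T)`. As `V ≥ 0`, the last term can be dropped, so
no stability estimate for the queue is needed. -/
lemma IsConvexSolution.avgCost_le {tax σ : ℝ} {V : ℕ → ℝ} (h : R.IsConvexSolution tax V σ)
    {φ : ℕ → Bool} (hφ : R.IsGreedy tax V φ) (x₀ : ℕ) :
    R.avgCost tax (stationary φ) x₀ ≤ σ := by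
  have hV : ∀ x, V x + σ = R.lookahead tax 1 V x (φ x) := fun x => by
    have h1 := h.dpe x
    cases hx : φ x with
    | true =>
      rw [min_eq_left ((hφ x).1 hx)] at h1
      simp only [lookahead, nextMean, if_true, Bool.toNat_true]
      push_cast
      linarith
    | false =>
      rw [min_eq_right ((hφ x).2 hx), passiveTerm] at h1
      rw [lookahead_false]
      linarith
  have hV0 : ∀ x, 0 ≤ V x := fun x => h.zero.ge.trans (h.shape.monotone (Nat.zero_le x))
  have hstep : ∀ n, R.meanCost tax (stationary φ) x₀ n =
      σ + R.meanAt V (stationary φ) x₀ n - R.meanAt V (stationary φ) x₀ (n + 1) := fun n => by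
    have h1 := R.meanAt_eq_of_eq_lookahead tax 1 V (fun x => V x + σ) φ hV x₀ n
    have h2 : R.meanAt (fun x => V x + σ) (stationary φ) x₀ n =
        R.meanAt V (stationary φ) x₀ n + σ := by
      unfold meanAt
      rw [integral_add (R.integrable_path (stationary φ) x₀ n fun s => V s.1) (integrable_const σ)]
      simp
    linarith
  have hsum : ∀ T : ℕ, ∑ n ∈ Finset.range T, R.meanCost tax (stationary φ) x₀ n =
      T * σ + V x₀ - R.meanAt V (stationary φ) x₀ T := fun T => by
    induction T with
    | zero => simp [meanAt_zero]
    | succ T ih => rw [Finset.sum_range_succ, ih, hstep]; push_cast; ring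
  have hle : ∀ᶠ T : ℕ in atTop,
      ((1 / (T : ℝ) * ∑ n ∈ Finset.range T, R.meanCost tax (stationary φ) x₀ n : ℝ) : EReal) ≤
        ((σ + V x₀ / T : ℝ) : EReal) := by
    filter_upwards [eventually_gt_atTop 0] with T hT
    have hT' : (0 : ℝ) < T := by exact_mod_cast hT
    have h1 : 0 ≤ R.meanAt V (stationary φ) x₀ T := integral_nonneg fun ω => hV0 _
    rw [EReal.coe_le_coe_iff, hsum, one_div, inv_mul_le_iff₀ hT', mul_add, mul_div_cancel₀ _ hT'.ne']
    linarith
  have hlim : Tendsto (fun T : ℕ => ((σ + V x₀ / T : ℝ) : EReal)) atTop (𝓝 (σ : EReal)) := by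
    refine (continuous_coe_real_ereal.tendsto σ).comp ?_
    simpa using (tendsto_const_div_atTop_nhds_zero_nat (V x₀)).const_add σ
  rw [avgCost_eq, ← hlim.limsup_eq]
  exact limsup_le_limsup hle

variable (R) in
lemma exists_isGreedy (tax : ℝ) (V : ℕ → ℝ) : ∃ φ, R.IsGreedy tax V φ := by
  classical
  refine ⟨fun x => decide (R.activeTerm V x ≤ R.passiveTerm tax V x), fun x => ⟨fun h => ?_,
    fun h => ?_⟩⟩
  · simpa using h
  · simp only [decide_eq_false_iff_not, not_le] at h
    exact h.le

lemma exists_averageCostSolution (hfl : R.f < R.l) (tax : ℝ) :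
    ∃ V σ, R.IsConvexSolution tax V σ ∧ R.IsAverageCostSolution tax V σ := by
  obtain ⟨V, σ, h, hV, hσ⟩ := R.exists_vanishing_discount_limit hfl tax
  -- The initial state does not matter: relative values converge, so `1 - γ` times them vanishes.
  have hσx : ∀ x, Tendsto (fun γ => (1 - γ) * R.discValue tax γ x) (𝓝[<] 1) (𝓝 σ) := fun x => by
    have h1 := (((tendsto_discount.const_sub 1).mul (hV x)).add hσ)
    simp only [sub_self, zero_mul, zero_add] at h1
    refine h1.congr fun γ => ?_
    rw [relValue]
    ring
  have hgreedy : ∀ φ, R.IsGreedy tax V φ → ∀ x₀, R.avgCost tax (stationary φ) x₀ = (σ : EReal) :=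
    fun φ hφ x₀ => le_antisymm (h.avgCost_le hφ x₀) (R.le_avgCost hfl (hσx x₀) _)
  refine ⟨V, σ, h, hV, hσ, h.dpe, fun x₀ => ⟨?_, ?_⟩, hgreedy⟩
  · obtain ⟨φ, hφ⟩ := R.exists_isGreedy tax V
    exact ⟨stationary φ, hgreedy φ hφ x₀⟩
  · rintro _ ⟨π, rfl⟩
    exact R.le_avgCost hfl (hσx x₀) π

theorem whittleIndexable (hfl : R.f < R.l) : R.WhittleIndexable := by
  choose V σ h hsol using fun tax => R.exists_averageCostSolution hfl tax
  refine ⟨V, σ, hsol, fun φ hφ => ⟨fun tax tax' hle x hx => ?_, ?_, fun x => ?_⟩⟩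
  · rcases hle.eq_or_lt with rfl | hlt
    · exact hx
    by_contra hne
    have ha := (R.activeTerm_le_iff tax (V tax) x).1
      ((hφ tax x).1 ((Bool.eq_false_or_eq_true _).resolve_right hne))
    have hp := (R.passiveTerm_le_iff tax' (V tax') x).1 ((hφ tax' x).2 hx)
    exact ((h tax).not_passive_of_active hfl (h tax') hlt ha).not_ge hp
  -- Under a negative tax passivity is strictly better everywhere, because slopes are nonnegative.
  · filter_upwards [eventually_lt_atBot 0] with tax htax
    refine eq_univ_of_forall fun x => (Bool.eq_false_or_eq_true _).resolve_left fun hx => ?_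
    have ha := (R.activeTerm_le_iff tax (V tax) x).1 ((hφ tax x).1 hx)
    have := mul_nonneg R.f_pos.le ((h tax).shape.serviceSlope_nonneg x)
    linarith
  -- The slope bound does not depend on the tax, so it yields an explicit threshold for each state.
  · filter_upwards [eventually_gt_atTop (R.f * (R.C / (R.l - R.f) * (x + 1 - R.l)))] with tax htax hx
    have hp := (R.passiveTerm_le_iff tax (V tax) x).1 ((hφ tax x).2 hx)
    have := mul_le_mul_of_nonneg_left ((h tax).shape.serviceSlope_le x) R.f_pos.le
    linarith

end Relay

end

theorem theorem2 (M : ℕ) (R : Fin M → Relay) (hstab : ∀ i j, (R i).f < (R j).l) :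
    ∀ i, (R i).WhittleIndexable :=
  fun i => Relay.whittleIndexable (hstab i i)
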